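/- Let $\Omega\subset\mathbb R^2$ be a bounded open set (for instance a bounded Lipschitz domain), $\|\cdot\|_\Omega$ the $L^2(\Omega)$ norm, and $H^1_0(\Omega)$ the closure of $C_c^\infty(\Omega)$ in $H^1(\Omega)$. Put $V=[H^1_0(\Omega)]^2$, $Q=\{q\in L^2(\Omega):\int_\Omega q=0\}$, $|v|_{1,\Omega}=\|\nabla v\|_\Omega$. Let $\mu,\epsilon>0$, $f\in[L^2(\Omega)]^2$, $g\in L^2(\Omega)$, let $E:\Omega\to\mathbb R^2$ be measurable with $|E|\le E^*$ a.e., $E^*>0$, and let $-\infty\le\Lambda_*\le 0\le\Lambda^*\le\infty$. Let $\kappa:\mathbb R\to\mathbb R$ be nondecreasing with $\kappa(0)=0$ and $|\kappa(s)-\kappa(t)|\le\kappa^*|s-t|$ for all real $s,t\in[\Lambda_*,\Lambda^*]$, $\kappa^*>0$ (for instance $\kappa(t)=\alpha_0\sinh(\alpha_1 t)$ with $\alpha_0,\alpha_1>0$ and finite $\Lambda_*,\Lambda^*$). Let $C_P,C_{1\to4}>0$ be constants with $\|v\|_\Omega\le C_P\|\nabla v\|_\Omega$ and $\|v\|_{L^4(\Omega)}\le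 C_{1\to4}\|\nabla v\|_\Omega$ for all $v\in H^1_0(\Omega)$. For $\psi\in H^1_0(\Omega)$ with values in $[\Lambda_*,\Lambda^*]$ write $\mathcal S_{flow}(\psi)=(\mathcal S_{1,flow}(\psi),\mathcal S_{2,flow}(\psi))=(u,p)$ if $(u,p)\in V\times Q$ satisfies, for all $(v,q)\in V\times Q$, $$\int_\Omega\mu\nabla u:\nabla v-\int_\Omega(\nabla\cdot v)p+\int_\Omega(\nabla\cdot u)q+\int_\Omega(u\cdot\nabla\psi)\,E\cdot v=\int_\Omega f\cdot v+\int_\Omega(g-\kappa(\psi))\,E\cdot v .$$ For $u\in V$ write $\mathcal N_{elec}(u)=\phi$ if $\phi\in H^1_0(\Omega)$, $\kappa(\phi)\xi$ is integrable for all $\xi\in H^1_0(\Omega)$, and $$\int_\Omega\epsilon\nabla\phi\cdot\nabla\xi+\int_\Omega(u\cdot\nabla\phi)\xi+\int_\Omega\kappa(\phi)\xi=\int_\Omega g\xi\qquad\text{for all }\xi\in H^1_0(\Omega).$$ Let $\mathcal T=\mathcal N_{elec}\circ\mathcal S_{1,flow}$; a priori these solution operators are regarded as multivalued, their values being all solutions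 of the respective problems. Let $$\widehat\Phi=\Big\{\psi\in H^1_0(\Omega):\ \|\nabla\psi\|_\Omega\le\frac{\mu}{2E^*C_{1\to4}^2},\ \Lambda_*\le\psi\le\Lambda^*\text{ a.e.}\Big\}.$$ **Theorem.** Assume $\dfrac{2C_PE^*C_{1\to4}^2}{\mu\epsilon}\|g\|_\Omega<1$. Then $\mathcal S_{1,flow}$ and $\mathcal T$ have at most one value at each $\psi\in\widehat\Phi$, and for all $\psi,\widehat\psi\in\widehat\Phi$ at which $\mathcal T$ has a value, $$|\mathcal T(\psi)-\mathcal T(\widehat\psi)|_{1,\Omega}\le\frac1\epsilon\Big[\kappa^*C_P^2+C_{1\to4}^2\,|\mathcal S_{1,flow}(\widehat\psi)|_{1,\Omega}\Big]\,\|\nabla(\psi-\widehat\psi)\|_\Omega .$$ -/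

import Mathlib

open MeasureTheory

noncomputable section

namespace SPB

/-- The Euclidean plane. -/
abbrev Plane := EuclideanSpace ℝ (Fin 2)

/-- The space `L²(Ω)` of real functions. -/
abbrev L2 (Ω : Set Plane) := Lp ℝ 2 (volume.restrict Ω)

/-- The space `L²(Ω; ℝ²)` of vector fields. -/
abbrev L2Vec (Ω : Set Plane) := Lp Plane 2 (volume.restrict Ω)

/-- Smooth functions with compact support in `Ω`. -/
structure IsTestFunction (Ω : Set Plane) (φ : Plane → ℝ) : Prop where
  smooth : ContDiff ℝ (⊤ : ℕ∞) φ
  compact : HasCompactSupport φ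
  support : tsupport φ ⊆ Ω

/-- The pairs `(φ, ∇φ)` with `φ` a test function, as elements of `L²(Ω) × L²(Ω; ℝ²)`. -/
def testGraph (Ω : Set Plane) : Set (L2 Ω × L2Vec Ω) :=
  {w | ∃ φ : Plane → ℝ, IsTestFunction Ω φ ∧
    (w.1 : Plane → ℝ) =ᵐ[volume.restrict Ω] φ ∧
    (w.2 : Plane → Plane) =ᵐ[volume.restrict Ω] fun x => gradient φ x}

/-- The Sobolev space `H¹₀(Ω)`, the closure of the test functions in the `H¹` norm. A function `v`
is represented by the pair `(v, ∇v)`; the second component is its weak gradient. -/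
def H10 (Ω : Set Plane) : Submodule ℝ (L2 Ω × L2Vec Ω) :=
  (Submodule.span ℝ (testGraph Ω)).topologicalClosure

/-- The function underlying an element of `H¹₀(Ω)`. -/
def fn {Ω : Set Plane} (v : H10 Ω) : L2 Ω := (v : L2 Ω × L2Vec Ω).1

/-- The weak gradient of an element of `H¹₀(Ω)`. The norm `‖grad v‖` is `|v|_{1,Ω}`. -/
def grad {Ω : Set Plane} (v : H10 Ω) : L2Vec Ω := (v : L2 Ω × L2Vec Ω).2

/-- The velocity space `V = [H¹₀(Ω)]²`, given by components. -/
abbrev Vel (Ω : Set Plane) := Fin 2 → H10 Ω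

/-- The pressure space `Q = L²₀(Ω)` of square-integrable functions with zero mean. -/
abbrev Pres (Ω : Set Plane) := {q : L2 Ω // ∫ x in Ω, q x = 0}

/-- The value at `x` of a velocity field. -/
def Vel.field {Ω : Set Plane} (u : Vel Ω) (x : Plane) : Plane :=
  WithLp.toLp 2 fun i => fn (u i) x

/-- The divergence at `x` of a velocity field. -/
def Vel.div {Ω : Set Plane} (u : Vel Ω) (x : Plane) : ℝ := ∑ i, (grad (u i) x) i

/-- The seminorm `|u|_{1,Ω} = ‖∇u‖_Ω` (Frobenius norm of the gradient, in `L²`). -/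
def Vel.seminorm {Ω : Set Plane} (u : Vel Ω) : ℝ := Real.sqrt (∑ i, ‖grad (u i)‖ ^ 2)

/-- The data of the Stokes-Poisson-Boltzmann problem: viscosity `μ`, permittivity `ε`, body force
`f`, potential load `g`, electric field `E` and charge density `κ`. -/
structure Data (Ω : Set Plane) where
  μ : ℝ
  ε : ℝ
  f : L2Vec Ω
  g : L2 Ω
  E : Plane → Plane
  κ : ℝ → ℝ

variable {Ω : Set Plane}

/-- `a_V(v, w) = ∫ μ ∇v : ∇w`. -/
def formAV (D : Data Ω) (v w : Vel Ω) : ℝ :=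
  ∫ x in Ω, D.μ * ∑ i, inner ℝ (grad (v i) x) (grad (w i) x)

/-- `b(v, q) = ∫ (∇ · v) q`. -/
def formB (v : Vel Ω) (q : Pres Ω) : ℝ := ∫ x in Ω, v.div x * q.1 x

/-- `c(ψ; v, w) = ∫ (v · ∇ψ) (E · w)`. -/
def formC (D : Data Ω) (ψ : H10 Ω) (v w : Vel Ω) : ℝ :=
  ∫ x in Ω, inner ℝ (v.field x) (grad ψ x) * inner ℝ (D.E x) (w.field x)

/-- `𝒜(ψ; (v, q), (w, r)) = a_V(v, w) - b(w, q) + b(v, r) + c(ψ; v, w)`. -/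
def formCalA (D : Data Ω) (ψ : H10 Ω) (v : Vel Ω) (q : Pres Ω) (w : Vel Ω) (r : Pres Ω) : ℝ :=
  formAV D v w - formB w q + formB v r + formC D ψ v w

/-- `F_ψ(v) = ∫ f · v + ∫ (g - κ(ψ)) E · v`. -/
def loadF (D : Data Ω) (ψ : H10 Ω) (v : Vel Ω) : ℝ :=
  (∫ x in Ω, inner ℝ (D.f x) (v.field x)) +
    ∫ x in Ω, (D.g x - D.κ (fn ψ x)) * inner ℝ (D.E x) (v.field x)

/-- `a_p(φ, ξ) = ∫ ε ∇φ · ∇ξ`. -/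
def formAP (D : Data Ω) (φ ξ : H10 Ω) : ℝ :=
  ∫ x in Ω, D.ε * inner ℝ (grad φ x) (grad ξ x)

/-- `c_p(u; φ, ξ) = ∫ (u · ∇φ) ξ`. -/
def formCP (u : Vel Ω) (φ ξ : H10 Ω) : ℝ :=
  ∫ x in Ω, inner ℝ (u.field x) (grad φ x) * fn ξ x

/-- `d(φ, ξ) = ∫ κ(φ) ξ`. -/
def formD (D : Data Ω) (φ ξ : H10 Ω) : ℝ := ∫ x in Ω, D.κ (fn φ x) * fn ξ x

/-- `ℬ(u; φ, ξ) = a_p(φ, ξ) + c_p(u; φ, ξ) + d(φ, ξ)`. -/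
def formCalB (D : Data Ω) (u : Vel Ω) (φ ξ : H10 Ω) : ℝ :=
  formAP D φ ξ + formCP u φ ξ + formD D φ ξ

/-- The flow solution operator `𝒮_flow`, as a relation: the set of all `(u, p) ∈ V × Q` with
`𝒜(ψ; (u, p), (v, q)) = F_ψ(v)` for all `(v, q) ∈ V × Q`. -/
def flow (D : Data Ω) (ψ : H10 Ω) : Set (Vel Ω × Pres Ω) :=
  {w | ∀ (v : Vel Ω) (q : Pres Ω), formCalA D ψ w.1 w.2 v q = loadF D ψ v}

/-- The velocity component `𝒮_{1,flow}` of the flow solution operator. -/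
def flow₁ (D : Data Ω) (ψ : H10 Ω) : Set (Vel Ω) := {u | ∃ p : Pres Ω, (u, p) ∈ flow D ψ}

/-- The potential solution operator `𝒩_elec`, as a relation: the set of all `φ ∈ H¹₀(Ω)` for which
the nonlinear term is defined and `ℬ(u; φ, ξ) = (g, ξ)` for all `ξ ∈ H¹₀(Ω)`. -/
def elec (D : Data Ω) (u : Vel Ω) : Set (H10 Ω) :=
  {φ | (∀ ξ : H10 Ω, IntegrableOn (fun x => D.κ (fn φ x) * fn ξ x) Ω) ∧
    ∀ ξ : H10 Ω, formCalB D u φ ξ = ∫ x in Ω, D.g x * fn ξ x}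

/-- The fixed-point operator `𝒯 = 𝒩_elec ∘ 𝒮_{1,flow}`, as a relation. -/
def opT (D : Data Ω) (ψ : H10 Ω) : Set (H10 Ω) := {φ | ∃ u ∈ flow₁ D ψ, φ ∈ elec D u}

/-- `C` is a constant of the Poincaré inequality `‖v‖_Ω ≤ C ‖∇v‖_Ω` on `H¹₀(Ω)`. -/
def IsPoincareConst (Ω : Set Plane) (C : ℝ) : Prop :=
  0 < C ∧ ∀ v : H10 Ω, ‖fn v‖ ≤ C * ‖grad v‖

/-- `C` is a constant of the Sobolev embedding `‖v‖_{0,4,Ω} ≤ C ‖∇v‖_Ω` on `H¹₀(Ω)`. -/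
def IsSobolevConst (Ω : Set Plane) (C : ℝ) : Prop :=
  0 < C ∧ ∀ v : H10 Ω, eLpNorm (fn v) 4 (volume.restrict Ω) ≤ ENNReal.ofReal (C * ‖grad v‖)

/-- The ball `{ψ : ‖∇ψ‖_Ω ≤ μ / (2 E* C²)}`, where the potentials have their values in
`[Λ₁, Λ₂]`. The bounds may be infinite. -/
def phiHat (D : Data Ω) (Estar C : ℝ) (Λ₁ Λ₂ : EReal) : Set (H10 Ω) :=
  {ψ | ‖grad ψ‖ ≤ D.μ / (2 * Estar * C ^ 2) ∧
    ∀ᵐ x ∂volume.restrict Ω, Λ₁ ≤ (fn ψ x : EReal) ∧ (fn ψ x : EReal) ≤ Λ₂}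

end SPB

end

/-! Everything follows from testing the weak equations with differences of solutions. A flow
velocity satisfies `formB u q = 0` for every pressure, so the pressures drop out of such
differences. Moreover div u has zero mean, hence is itself a pressure, and div u = 0 a.e.
(`Vel.div_eq_zero`); this makes the convection form vanish on the diagonal (`formCP_self`).

Flow: for w = u - u', the term c(ψ; w, w) costs at most half of the viscous energy on the ball
`phiHat`, and what remains is linear in ∇(ψ - ψ'). This gives `seminorm_sub_le_of_mem_flow₁`, with
constant 2E*/μ times the bracket of the theorem.

Potential: convection disappears and the monotone κ contributes with a favourable sign. Hence ε|φ -
φ'| ≤ C²|u - u'||φ'| and ε|φ'| ≤ C_P‖g‖. Chaining the three bounds produces the quantity assumed to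
be less than 1, times the bracket over ε. Uniqueness is the case ψ = ψ'. -/

noncomputable section

namespace SPB

/-! ### Hölder estimates for integrals of products -/

section Holder

variable {α F G H : Type*} {m : MeasurableSpace α} {ν : Measure α} [NormedAddCommGroup F]
  [NormedAddCommGroup G] [NormedAddCommGroup H]

lemma integrable_and_abs_integral_le_of_eLpNorm_one_le {h : α → ℝ}
    (hm : AEStronglyMeasurable h ν) {K : ℝ} (hK : 0 ≤ K)
    (hh : eLpNorm h 1 ν ≤ ENNReal.ofReal K) : Integrable h ν ∧ |∫ x, h x ∂ν| ≤ K := by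
  have hi : Integrable h ν :=
    memLp_one_iff_integrable.1 ⟨hm, hh.trans_lt ENNReal.ofReal_lt_top⟩
  refine ⟨hi, ?_⟩
  have h1 := (enorm_integral_le_lintegral_enorm (μ := ν) h).trans
    (eLpNorm_one_eq_lintegral_enorm.symm.le.trans hh)
  rw [← ofReal_norm, ENNReal.ofReal_le_ofReal_iff hK] at h1
  exact h1

lemma eLpNorm_norm_mul_norm_le {p q r : ENNReal} [p.HolderTriple q r] {a : α → F} {b : α → G}
    (ha : AEStronglyMeasurable a ν) (hb : AEStronglyMeasurable b ν) :
    eLpNorm (fun x => ‖a x‖ * ‖b x‖) r ν ≤ eLpNorm a p ν * eLpNorm b q ν := by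
  have := eLpNorm_smul_le_mul_eLpNorm (r := r) (p := p) (q := q) (μ := ν) hb.norm ha.norm
  rwa [eLpNorm_norm, eLpNorm_norm] at this

/-- The Cauchy-Schwarz inequality for functions dominated by a product. -/
lemma integrable_and_abs_integral_le_of_le_mul {h : α → ℝ} {a : α → F} {b : α → G}
    {c A B : ℝ} (hm : AEStronglyMeasurable h ν) (ha : AEStronglyMeasurable a ν)
    (hb : AEStronglyMeasurable b ν) (hc : 0 ≤ c) (hA : 0 ≤ A) (hB : 0 ≤ B)
    (hh : ∀ᵐ x ∂ν, |h x| ≤ c * (‖a x‖ * ‖b x‖))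
    (haA : eLpNorm a 2 ν ≤ ENNReal.ofReal A) (hbB : eLpNorm b 2 ν ≤ ENNReal.ofReal B) :
    Integrable h ν ∧ |∫ x, h x ∂ν| ≤ c * (A * B) := by
  refine integrable_and_abs_integral_le_of_eLpNorm_one_le hm (by positivity) ?_
  rw [ENNReal.ofReal_mul hc, ENNReal.ofReal_mul hA]
  refine (eLpNorm_le_mul_eLpNorm_of_ae_le_mul (g := fun x => ‖a x‖ * ‖b x‖) (c := c) ?_ 1).trans ?_
  · filter_upwards [hh] with x hx
    simpa [abs_of_nonneg] using hx
  · gcongr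
    exact (eLpNorm_norm_mul_norm_le (p := 2) (q := 2) ha hb).trans (by gcongr)

lemma holderTriple_four_two : ENNReal.HolderTriple 4 4 2 where
  inv_add_inv_eq_inv := by
    rw [← two_mul, show (4 : ENNReal) = 2 * 2 by norm_num,
      ENNReal.mul_inv (by simp) (by simp), ← mul_assoc, ENNReal.mul_inv_cancel (by simp) (by simp),
      one_mul]

/-- Hölder's inequality with exponents `4`, `2`, `4` for functions dominated by a product. -/
lemma integrable_and_abs_integral_le_of_le_mul_mul {h : α → ℝ} {a : α → F} {b : α → G}
    {d : α → H} {c A B K : ℝ} (hm : AEStronglyMeasurable h ν) (ha : AEStronglyMeasurable a ν)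
    (hb : AEStronglyMeasurable b ν) (hd : AEStronglyMeasurable d ν)
    (hc : 0 ≤ c) (hA : 0 ≤ A) (hB : 0 ≤ B) (hK : 0 ≤ K)
    (hh : ∀ᵐ x ∂ν, |h x| ≤ c * (‖a x‖ * ‖b x‖ * ‖d x‖))
    (haA : eLpNorm a 4 ν ≤ ENNReal.ofReal A) (hbB : eLpNorm b 2 ν ≤ ENNReal.ofReal B)
    (hdK : eLpNorm d 4 ν ≤ ENNReal.ofReal K) :
    Integrable h ν ∧ |∫ x, h x ∂ν| ≤ c * (A * B * K) := by
  have := holderTriple_four_two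
  -- The two `L⁴` factors are grouped into one `L²` function, which reduces the claim to
  -- Cauchy-Schwarz.
  have key := integrable_and_abs_integral_le_of_le_mul (ν := ν) (h := h)
    (a := fun x => ‖a x‖ * ‖d x‖) (b := b) (c := c) (A := A * K) (B := B) hm
    (ha.norm.mul hd.norm) hb hc (by positivity) hB ?_ ?_ hbB
  · convert key using 3
    ring
  · filter_upwards [hh] with x hx
    refine hx.trans_eq ?_
    rw [norm_mul, norm_norm, norm_norm]
    ring
  · rw [ENNReal.ofReal_mul hA]
    exact (eLpNorm_norm_mul_norm_le (p := 4) (q := 4) ha hd).trans (by gcongr)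

/-- A bound of the `Lᵖ` norm of a vector field by the norms of its components, `p ≥ 2`. -/
lemma eLpNorm_toLp_le {ι : Type*} [Fintype ι] {w : ι → α → ℝ} {r : ENNReal} (hr : 1 ≤ r) {C : ℝ}
    (hC : 0 ≤ C) {a : ι → ℝ} (ha : ∀ i, 0 ≤ a i) (hw : ∀ i, AEStronglyMeasurable (w i) ν)
    (h : ∀ i, eLpNorm (w i) (r * 2) ν ≤ ENNReal.ofReal (C * a i)) :
    eLpNorm (fun x => (WithLp.toLp 2 fun i => w i x : EuclideanSpace ℝ ι)) (r * 2) ν ≤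
      ENNReal.ofReal (C * √(∑ i, a i ^ 2)) := by
  have h2 : ENNReal.ofReal 2 = 2 := by simp
  have hs : (0 : ℝ) ≤ ∑ i, a i ^ 2 := Finset.sum_nonneg fun i _ => sq_nonneg _
  -- After squaring, the Euclidean norm becomes a sum of squares, and the triangle inequality in
  -- `Lʳ` applies. The constant `C` of the scalar inequality thus carries over to vector fields
  -- without loss.
  rw [← ENNReal.rpow_le_rpow_iff (z := 2) (by norm_num)]
  have e1 := eLpNorm_norm_rpow (p := r) (q := 2) (μ := ν)
    (fun x => (WithLp.toLp 2 fun i => w i x : EuclideanSpace ℝ ι)) (by norm_num)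
  rw [h2] at e1
  rw [← e1]
  have e2 : (fun x => ‖(WithLp.toLp 2 fun i => w i x : EuclideanSpace ℝ ι)‖ ^ (2 : ℝ)) =
      ∑ i, fun x => ‖w i x‖ ^ (2 : ℝ) := by
    ext x
    simp [EuclideanSpace.norm_sq_eq]
  rw [e2]
  refine (eLpNorm_sum_le (fun i _ => ?_) hr).trans ?_
  · exact ((hw i).norm.aemeasurable.pow_const 2).aestronglyMeasurable
  · calc ∑ i, eLpNorm (fun x => ‖w i x‖ ^ (2 : ℝ)) r ν
        = ∑ i, eLpNorm (w i) (r * 2) ν ^ (2 : ℝ) := by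
          refine Finset.sum_congr rfl fun i _ => ?_
          rw [eLpNorm_norm_rpow _ (by norm_num), h2]
      _ ≤ ∑ i, ENNReal.ofReal (C * a i) ^ (2 : ℝ) := by
          gcongr with i
          exact h i
      _ = ENNReal.ofReal (∑ i, (C * a i) ^ (2 : ℝ)) := by
          rw [ENNReal.ofReal_sum_of_nonneg fun i _ => by have := ha i; positivity]
          refine Finset.sum_congr rfl fun i _ => ?_
          rw [ENNReal.ofReal_rpow_of_nonneg (mul_nonneg hC (ha i)) (by norm_num)]
      _ = ENNReal.ofReal (C * √(∑ i, a i ^ 2)) ^ (2 : ℝ) := by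
          rw [ENNReal.ofReal_rpow_of_nonneg (by positivity) (by norm_num)]
          congr 1
          simp only [Real.rpow_two, mul_pow, Real.sq_sqrt hs, Finset.mul_sum]

end Holder

/-! ### Differences, measurability and norms in H¹₀(Ω) and V -/

variable {Ω : Set Plane}

lemma fn_sub_ae (v w : H10 Ω) :
    ∀ᵐ x ∂volume.restrict Ω, fn (v - w) x = fn v x - fn w x :=
  Lp.coeFn_sub (fn v) (fn w)

lemma grad_sub_ae (v w : H10 Ω) :
    ∀ᵐ x ∂volume.restrict Ω, grad (v - w) x = grad v x - grad w x :=
  Lp.coeFn_sub (grad v) (grad w)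

lemma Vel.field_sub_ae (u v : Vel Ω) :
    ∀ᵐ x ∂volume.restrict Ω, Vel.field (u - v) x = Vel.field u x - Vel.field v x := by
  filter_upwards [fn_sub_ae (u 0) (v 0), fn_sub_ae (u 1) (v 1)] with x h0 h1
  ext i
  fin_cases i
  · exact h0
  · exact h1

lemma Vel.div_sub_ae (u v : Vel Ω) :
    ∀ᵐ x ∂volume.restrict Ω, Vel.div (u - v) x = Vel.div u x - Vel.div v x := by
  filter_upwards [grad_sub_ae (u 0) (v 0), grad_sub_ae (u 1) (v 1)] with x h0 h1
  simp only [Vel.div, Fin.sum_univ_two, Pi.sub_apply, h0, h1, PiLp.sub_apply]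
  ring

lemma Vel.seminorm_nonneg (u : Vel Ω) : 0 ≤ Vel.seminorm u := Real.sqrt_nonneg _

lemma Vel.seminorm_sq (u : Vel Ω) : Vel.seminorm u ^ 2 = ∑ i, ‖grad (u i)‖ ^ 2 :=
  Real.sq_sqrt (Finset.sum_nonneg fun _ _ => sq_nonneg _)

lemma eLpNorm_Lp {F : Type*} [NormedAddCommGroup F] {α : Type*} {m : MeasurableSpace α}
    {ν : Measure α} {p : ENNReal} (v : Lp F p ν) : eLpNorm v p ν = ENNReal.ofReal ‖v‖ := by
  rw [Lp.norm_def, ENNReal.ofReal_toReal (Lp.eLpNorm_ne_top v)]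

lemma aestronglyMeasurable_fn (v : H10 Ω) :
    AEStronglyMeasurable (fn v : Plane → ℝ) (volume.restrict Ω) := Lp.aestronglyMeasurable _

lemma aestronglyMeasurable_grad (v : H10 Ω) :
    AEStronglyMeasurable (grad v : Plane → Plane) (volume.restrict Ω) := Lp.aestronglyMeasurable _

lemma Vel.memLp_field (u : Vel Ω) : MemLp (Vel.field u) 2 (volume.restrict Ω) :=
  MemLp.of_eval_piLp fun i => Lp.memLp (fn (u i))

lemma Vel.aestronglyMeasurable_field (u : Vel Ω) :
    AEStronglyMeasurable (Vel.field u) (volume.restrict Ω) := u.memLp_field.1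

lemma Vel.memLp_div (u : Vel Ω) : MemLp (Vel.div u) 2 (volume.restrict Ω) :=
  memLp_finsetSum _ fun i _ => (Lp.memLp (grad (u i))).eval_piLp i

lemma Vel.eLpNorm_field_two_le {CP : ℝ} (hCP : IsPoincareConst Ω CP) (u : Vel Ω) :
    eLpNorm (Vel.field u) 2 (volume.restrict Ω) ≤ ENNReal.ofReal (CP * Vel.seminorm u) := by
  have := eLpNorm_toLp_le (ν := volume.restrict Ω) (w := fun i => fn (u i)) (r := 1) le_rfl
    hCP.1.le (a := fun i => ‖grad (u i)‖) (fun i => norm_nonneg _)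
    (fun i => aestronglyMeasurable_fn _) fun i => by
      rw [one_mul, eLpNorm_Lp]
      exact ENNReal.ofReal_le_ofReal (hCP.2 (u i))
  rwa [one_mul] at this

lemma Vel.eLpNorm_field_four_le {C : ℝ} (hC : IsSobolevConst Ω C) (u : Vel Ω) :
    eLpNorm (Vel.field u) 4 (volume.restrict Ω) ≤ ENNReal.ofReal (C * Vel.seminorm u) := by
  have h4 : (2 : ENNReal) * 2 = 4 := by norm_num
  have := eLpNorm_toLp_le (ν := volume.restrict Ω) (w := fun i => fn (u i)) (r := 2)
    (by norm_num) hC.1.le (a := fun i => ‖grad (u i)‖) (fun i => norm_nonneg _)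
    (fun i => aestronglyMeasurable_fn _) fun i => by
      rw [h4]
      exact hC.2 (u i)
  rwa [h4] at this

/-- An element of `H10 Ω` is a pair, and the Poincaré inequality is what forces its first component
to vanish with the second. -/
lemma IsPoincareConst.eq_zero {CP : ℝ} (hCP : IsPoincareConst Ω CP) {v : H10 Ω}
    (h : ‖grad v‖ = 0) : v = 0 := by
  have h0 : ‖fn v‖ = 0 := le_antisymm (by simpa [h] using hCP.2 v) (norm_nonneg _)
  exact Subtype.ext (Prod.ext (norm_eq_zero.1 h0) (norm_eq_zero.1 h))

lemma IsPoincareConst.vel_eq {CP : ℝ} (hCP : IsPoincareConst Ω CP) {u v : Vel Ω}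
    (h : Vel.seminorm (u - v) = 0) : u = v := by
  have h2 := Vel.seminorm_sq (u - v)
  rw [h, zero_pow two_ne_zero, eq_comm, Finset.sum_eq_zero_iff_of_nonneg fun _ _ => sq_nonneg _] at h2
  funext i
  exact sub_eq_zero.1 (hCP.eq_zero (v := u i - v i) (pow_eq_zero_iff two_ne_zero |>.1 (h2 i (by simp))))

/-! ### Integration by parts and divergence-free velocities -/

/-- A bounded set has finite measure and compact closure, on which `h` is bounded. Smooth functions
without compact support can therefore be paired with elements of H¹₀(Ω). -/
lemma memLp_of_continuous {F : Type*} [NormedAddCommGroup F] [SecondCountableTopology F]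
    (hΩb : Bornology.IsBounded Ω) {h : Plane → F} (hh : Continuous h) :
    MemLp h 2 (volume.restrict Ω) := by
  have : IsFiniteMeasure (volume.restrict Ω) := ⟨by simpa using hΩb.measure_lt_top⟩
  obtain ⟨K, hK⟩ := hΩb.isCompact_closure.exists_bound_of_continuousOn hh.continuousOn
  refine MemLp.of_bound hh.aestronglyMeasurable K ?_
  have h1 : ∀ᵐ x ∂volume.restrict (closure Ω), ‖h x‖ ≤ K :=
    (ae_restrict_iff' isClosed_closure.measurableSet).2 (.of_forall hK)
  exact ae_mono (Measure.restrict_mono subset_closure le_rfl) h1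

lemma continuous_gradient {η : Plane → ℝ} (hη : ContDiff ℝ (⊤ : ℕ∞) η) :
    Continuous (gradient η) :=
  (InnerProductSpace.toDual ℝ Plane).symm.continuous.comp (hη.continuous_fderiv (by simp))

lemma gradient_apply (η : Plane → ℝ) (x : Plane) (i : Fin 2) :
    gradient η x i = fderiv ℝ η x (EuclideanSpace.single i 1) := by
  rw [← inner_gradient_left, EuclideanSpace.inner_single_right]
  simp

/-- Integration by parts for a test function. -/
lemma IsTestFunction.integral_parts {φ η : Plane → ℝ} (hφ : IsTestFunction Ω φ)
    (hη : ContDiff ℝ (⊤ : ℕ∞) η) (i : Fin 2) :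
    ∫ x in Ω, (φ x * gradient η x i + gradient φ x i * η x) = 0 := by
  have hcη := continuous_gradient hη
  have hcφ := continuous_gradient hφ.smooth
  -- The integrand vanishes off Ω, so the integral is taken over the whole plane and no regularity
  -- of the boundary matters.
  have sub : ∀ x ∉ Ω, φ x = 0 ∧ gradient φ x = 0 := by
    intro x hx
    have hx' : x ∉ tsupport φ := fun h => hx (hφ.support h)
    refine ⟨image_eq_zero_of_notMem_tsupport hx', ?_⟩
    have : φ =ᶠ[nhds x] fun _ => 0 := notMem_tsupport_iff_eventuallyEq.1 hx'
    rw [this.gradient_eq, gradient_fun_const]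
  rw [setIntegral_eq_integral_of_forall_compl_eq_zero
    (fun x hx => by simp [(sub x hx).1, (sub x hx).2])]
  have gsupp : HasCompactSupport fun x => gradient φ x i := by
    simp_rw [gradient_apply]
    exact (hφ.compact.fderiv ℝ).comp_left (g := fun L : Plane →L[ℝ] ℝ =>
      L (EuclideanSpace.single i 1)) rfl
  have ci : Continuous fun x => gradient φ x i := by fun_prop
  have cη : Continuous fun x => gradient η x i := by fun_prop
  have i1 : Integrable fun x => φ x * gradient η x i :=
    (hφ.smooth.continuous.mul cη).integrable_of_hasCompactSupport hφ.compact.mul_right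
  have i2 : Integrable fun x => gradient φ x i * η x :=
    (ci.mul hη.continuous).integrable_of_hasCompactSupport gsupp.mul_right
  have i3 : Integrable fun x => φ x * η x :=
    (hφ.smooth.continuous.mul hη.continuous).integrable_of_hasCompactSupport
      hφ.compact.mul_right
  rw [integral_add i1 i2]
  simp_rw [gradient_apply] at i1 i2 ⊢
  rw [integral_mul_fderiv_eq_neg_fderiv_mul_of_integrable i2 i1 i3
    (fun x _ => (hφ.smooth.differentiable (by simp)) x)
    (fun x _ => (hη.differentiable (by simp)) x), neg_add_cancel]

lemma integrable_mul_of_memLp_two {α : Type*} {m : MeasurableSpace α} {ν : Measure α}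
    {a b : α → ℝ} (ha : MemLp a 2 ν) (hb : MemLp b 2 ν) : Integrable (fun x => a x * b x) ν :=
  ha.integrable_mul hb

/-- Integration by parts in `H¹₀(Ω)` against a smooth function. -/
lemma integral_fn_mul_gradient (hΩb : Bornology.IsBounded Ω) (v : H10 Ω) {η : Plane → ℝ}
    (hη : ContDiff ℝ (⊤ : ℕ∞) η) (i : Fin 2) :
    ∫ x in Ω, (fn v x * gradient η x i + grad v x i * η x) = 0 := by
  have hcη := continuous_gradient hη
  have cη : Continuous fun x => gradient η x i := by fun_prop
  have cs : Continuous fun x => η x • (EuclideanSpace.single i 1 : Plane) :=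
    hη.continuous.smul continuous_const
  have mA := memLp_of_continuous hΩb cη
  have mB := memLp_of_continuous hΩb cs
  -- The identity says that a continuous functional on pairs vanishes. Its kernel is closed, so it
  -- suffices to check test functions.
  let L : (L2 Ω × L2Vec Ω) →L[ℝ] ℝ :=
    (innerSL ℝ (mA.toLp _)).comp (ContinuousLinearMap.fst ℝ _ _) +
      (innerSL ℝ (mB.toLp _)).comp (ContinuousLinearMap.snd ℝ _ _)
  have hL : ∀ w, L w = ∫ x in Ω, (w.1 x * gradient η x i + w.2 x i * η x) := by
    intro w
    have e1 : L w = inner ℝ (mA.toLp _) w.1 + inner ℝ (mB.toLp _) w.2 := rfl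
    rw [e1, L2.inner_def, L2.inner_def, ← integral_add (L2.integrable_inner _ _)
      (L2.integrable_inner _ _)]
    refine integral_congr_ae ?_
    filter_upwards [mA.coeFn_toLp, mB.coeFn_toLp] with x h1 h2
    rw [h1, h2, inner_smul_left, EuclideanSpace.inner_single_left]
    simp [mul_comm]
  have hker : (Submodule.span ℝ (testGraph Ω)).topologicalClosure ≤ LinearMap.ker L.toLinearMap := by
    refine Submodule.topologicalClosure_minimal _ (Submodule.span_le.2 ?_) L.isClosed_ker
    rintro w ⟨φ, hφ, h1, h2⟩
    refine (hL w).trans ?_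
    rw [← hφ.integral_parts hη i]
    refine integral_congr_ae ?_
    filter_upwards [h1, h2] with x h1 h2
    rw [h1, h2]
  exact (hL v).symm.trans (hker v.2)

/-- The divergence theorem for velocity fields against a smooth function. -/
lemma Vel.integral_inner_gradient (hΩb : Bornology.IsBounded Ω) (u : Vel Ω) {η : Plane → ℝ}
    (hη : ContDiff ℝ (⊤ : ℕ∞) η) :
    ∫ x in Ω, (inner ℝ (Vel.field u x) (gradient η x) + Vel.div u x * η x) = 0 := by
  have hcη := continuous_gradient hη
  have hi : ∀ i, Integrable (fun x => fn (u i) x * gradient η x i + grad (u i) x i * η x)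
      (volume.restrict Ω) := fun i =>
    (integrable_mul_of_memLp_two (Lp.memLp (fn (u i)))
      (memLp_of_continuous hΩb (h := fun x => gradient η x i) (by fun_prop))).add
    (integrable_mul_of_memLp_two ((Lp.memLp (grad (u i))).eval_piLp i)
      (memLp_of_continuous hΩb hη.continuous))
  calc _ = ∫ x in Ω, ∑ i, (fn (u i) x * gradient η x i + grad (u i) x i * η x) := by
        congr 1
        ext x
        simp only [Vel.field, Vel.div, PiLp.inner_apply, Fin.sum_univ_two, RCLike.inner_apply,
          conj_trivial]
        ring
    _ = 0 := by
        rw [integral_finsetSum _ fun i _ => hi i]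
        exact Finset.sum_eq_zero fun i _ => integral_fn_mul_gradient hΩb (u i) hη i

/-- A velocity field whose divergence is orthogonal to the pressures is divergence free. -/
lemma Vel.div_eq_zero (hΩb : Bornology.IsBounded Ω) {u : Vel Ω}
    (hu : ∀ q : Pres Ω, formB u q = 0) : ∀ᵐ x ∂volume.restrict Ω, Vel.div u x = 0 := by
  have m := u.memLp_div
  -- The divergence theorem with η = 1 gives zero mean, so the divergence is itself an admissible
  -- pressure.
  have h0 : ∫ x in Ω, Vel.div u x = 0 := by
    have := u.integral_inner_gradient hΩb (η := fun _ => 1) contDiff_const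
    simpa [gradient_fun_const] using this
  let q : Pres Ω := ⟨m.toLp _, by rw [← h0]; exact integral_congr_ae m.coeFn_toLp⟩
  have hq : ∫ x in Ω, Vel.div u x * Vel.div u x = 0 := by
    rw [← hu q]
    refine integral_congr_ae ?_
    filter_upwards [m.coeFn_toLp] with x hx
    rw [hx]
  have := (integral_eq_zero_iff_of_nonneg (fun x => mul_self_nonneg _)
    (integrable_mul_of_memLp_two m m)).1 hq
  filter_upwards [this] with x hx
  exact mul_self_eq_zero.1 hx

/-! ### The convection form and its vanishing on the diagonal -/

lemma formCP_bound {C : ℝ} (hC : IsSobolevConst Ω C) (u : Vel Ω) (φ ξ : H10 Ω) :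
    IntegrableOn (fun x => inner ℝ (Vel.field u x) (grad φ x) * fn ξ x) Ω ∧
      |formCP u φ ξ| ≤ C ^ 2 * Vel.seminorm u * ‖grad φ‖ * ‖grad ξ‖ := by
  have hs := u.seminorm_nonneg
  have hC0 := hC.1
  have := integrable_and_abs_integral_le_of_le_mul_mul (ν := volume.restrict Ω)
    (h := fun x => inner ℝ (Vel.field u x) (grad φ x) * fn ξ x) (c := 1)
    ((u.aestronglyMeasurable_field.inner (aestronglyMeasurable_grad φ)).mul
      (aestronglyMeasurable_fn ξ)) u.aestronglyMeasurable_field (aestronglyMeasurable_grad φ)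
    (aestronglyMeasurable_fn ξ) zero_le_one (by positivity) (norm_nonneg (grad φ)) (by positivity)
    (.of_forall fun x => by
      rw [one_mul, abs_mul]
      exact mul_le_mul_of_nonneg_right (abs_real_inner_le_norm _ _) (abs_nonneg _))
    (u.eLpNorm_field_four_le hC) (eLpNorm_Lp _).le (hC.2 ξ)
  refine ⟨this.1, this.2.trans_eq ?_⟩
  ring

lemma formCP_sub_mid {C : ℝ} (hC : IsSobolevConst Ω C) (u : Vel Ω) (φ φ' ξ : H10 Ω) :
    formCP u (φ - φ') ξ = formCP u φ ξ - formCP u φ' ξ := by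
  unfold formCP
  rw [← integral_sub (formCP_bound hC u φ ξ).1 (formCP_bound hC u φ' ξ).1]
  refine integral_congr_ae ?_
  filter_upwards [grad_sub_ae φ φ'] with x hx
  rw [hx, inner_sub_right]
  ring

lemma formCP_sub_right {C : ℝ} (hC : IsSobolevConst Ω C) (u : Vel Ω) (φ ξ ξ' : H10 Ω) :
    formCP u φ (ξ - ξ') = formCP u φ ξ - formCP u φ ξ' := by
  unfold formCP
  rw [← integral_sub (formCP_bound hC u φ ξ).1 (formCP_bound hC u φ ξ').1]
  refine integral_congr_ae ?_
  filter_upwards [fn_sub_ae ξ ξ'] with x hx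
  rw [hx]
  ring

lemma formCP_sub_left {C : ℝ} (hC : IsSobolevConst Ω C) (u u' : Vel Ω) (φ ξ : H10 Ω) :
    formCP (u - u') φ ξ = formCP u φ ξ - formCP u' φ ξ := by
  unfold formCP
  rw [← integral_sub (formCP_bound hC u φ ξ).1 (formCP_bound hC u' φ ξ).1]
  refine integral_congr_ae ?_
  filter_upwards [u.field_sub_ae u'] with x hx
  rw [hx, inner_sub_left]
  ring

lemma gradient_add {φ η : Plane → ℝ} (hφ : ContDiff ℝ (⊤ : ℕ∞) φ) (hη : ContDiff ℝ (⊤ : ℕ∞) η)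
    (x : Plane) : gradient (φ + η) x = gradient φ x + gradient η x := by
  simp only [gradient]
  rw [fderiv_add (hφ.differentiable (by simp) x) (hη.differentiable (by simp) x), map_add]

lemma gradient_smul {φ : Plane → ℝ} (hφ : ContDiff ℝ (⊤ : ℕ∞) φ) (c : ℝ)
    (x : Plane) : gradient (c • φ) x = c • gradient φ x := by
  simp only [gradient]
  rw [fderiv_const_smul (hφ.differentiable (by simp) x), map_smul]

/-- The pairs `(φ, ∇φ)` with `φ` a test function form a subspace. -/
lemma mem_testGraph_of_mem_span {w : L2 Ω × L2Vec Ω} (hw : w ∈ Submodule.span ℝ (testGraph Ω)) :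
    w ∈ testGraph Ω := by
  induction hw using Submodule.span_induction with
  | mem w h => exact h
  | zero =>
    refine ⟨0, ⟨contDiff_const, HasCompactSupport.zero, by simp⟩, Lp.coeFn_zero _ _ _, ?_⟩
    refine (Lp.coeFn_zero _ _ _).trans (.of_forall fun x => ?_)
    exact (gradient_fun_const x (0 : ℝ)).symm
  | add w w' _ _ h h' =>
    obtain ⟨φ, hφ, h1, h2⟩ := h
    obtain ⟨φ', hφ', h1', h2'⟩ := h'
    refine ⟨φ + φ', ⟨hφ.smooth.add hφ'.smooth, hφ.compact.add hφ'.compact,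
      (tsupport_add φ φ').trans (Set.union_subset hφ.support hφ'.support)⟩, ?_, ?_⟩
    · exact (Lp.coeFn_add _ _).trans (h1.add h1')
    · refine (Lp.coeFn_add _ _).trans ?_
      filter_upwards [h2, h2'] with x h h'
      rw [gradient_add hφ.smooth hφ'.smooth, Pi.add_apply, h, h']
  | smul c w _ h =>
    obtain ⟨φ, hφ, h1, h2⟩ := h
    refine ⟨c • φ, ⟨hφ.smooth.const_smul c, hφ.compact.smul_left (f := fun _ => c),
      (tsupport_smul_subset_right (fun _ => c) φ).trans hφ.support⟩, ?_, ?_⟩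
    · exact (Lp.coeFn_smul _ _).trans (h1.const_smul c)
    · refine (Lp.coeFn_smul _ _).trans ?_
      filter_upwards [h2] with x h
      rw [gradient_smul hφ.smooth, Pi.smul_apply, h]

/-- Since 2(u · ∇φ)φ = u · ∇(φ²), the divergence theorem with η = φ² applies. -/
lemma formCP_self_of_mem_testGraph (hΩb : Bornology.IsBounded Ω) {u : Vel Ω}
    (hu : ∀ᵐ x ∂volume.restrict Ω, Vel.div u x = 0) {v : H10 Ω}
    (hv : (v : L2 Ω × L2Vec Ω) ∈ testGraph Ω) : formCP u v v = 0 := by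
  obtain ⟨φ, hφ, h1, h2⟩ := hv
  have hg : ∀ x, gradient (fun y => φ y * φ y) x = (2 * φ x) • gradient φ x := by
    intro x
    have hd := hφ.smooth.differentiable (by simp) x
    simp only [gradient]
    rw [fderiv_fun_mul hd hd, ← two_smul ℝ, map_smul, map_smul, smul_smul]
  have key := u.integral_inner_gradient hΩb (hφ.smooth.mul hφ.smooth)
  have : ∫ x in Ω, 2 * (inner ℝ (Vel.field u x) (grad v x) * fn v x) = 0 := by
    rw [← key]
    refine integral_congr_ae ?_
    filter_upwards [h1, h2, hu] with x h1 h2 hx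
    rw [hg, hx, inner_smul_right, grad, fn, h1, h2]
    ring
  rw [integral_const_mul] at this
  simpa [formCP] using this

open Filter Topology in
/-- The convection form of a divergence free field is skew-symmetric. -/
lemma formCP_self {C : ℝ} (hC : IsSobolevConst Ω C) (hΩb : Bornology.IsBounded Ω) {u : Vel Ω}
    (hu : ∀ᵐ x ∂volume.restrict Ω, Vel.div u x = 0) (v : H10 Ω) : formCP u v v = 0 := by
  -- The form is quadratic in `v`, so vanishing on generators of the span would not be enough; the
  -- approximants must be test functions themselves, which `mem_testGraph_of_mem_span` ensures.
  obtain ⟨t, ht, htv⟩ := mem_closure_iff_seq_limit.1 v.2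
  let T : ℕ → H10 Ω := fun n => ⟨t n, subset_closure (ht n)⟩
  have hT : Tendsto (fun n => ‖grad (T n)‖) atTop (𝓝 ‖grad v‖) :=
    ((continuous_snd.tendsto _).comp htv).norm
  have hd : Tendsto (fun n => ‖grad (v - T n)‖) atTop (𝓝 0) := by
    have := ((tendsto_const_nhds (x := grad v)).sub ((continuous_snd.tendsto _).comp htv)).norm
    rwa [grad, sub_self, norm_zero] at this
  have hle : ∀ n, |formCP u v v| ≤ C ^ 2 * Vel.seminorm u * ‖grad (v - T n)‖ * ‖grad v‖ +
      C ^ 2 * Vel.seminorm u * ‖grad (T n)‖ * ‖grad (v - T n)‖ := by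
    intro n
    have e : formCP u v v = formCP u (v - T n) v + formCP u (T n) (v - T n) := by
      rw [formCP_sub_mid hC, formCP_sub_right hC,
        formCP_self_of_mem_testGraph hΩb hu (v := T n) (mem_testGraph_of_mem_span (ht n))]
      ring
    rw [e]
    exact (abs_add_le _ _).trans (add_le_add (formCP_bound hC _ _ _).2 (formCP_bound hC _ _ _).2)
  have hlim := ((hd.const_mul (C ^ 2 * Vel.seminorm u)).mul_const ‖grad v‖).add
    ((hT.const_mul (C ^ 2 * Vel.seminorm u)).mul hd)
  have := ge_of_tendsto' hlim hle
  simpa using this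

/-! ### The viscous form and the incompressibility constraint -/

lemma integrableOn_formAV (D : Data Ω) (v w : Vel Ω) :
    IntegrableOn (fun x => D.μ * ∑ i, inner ℝ (grad (v i) x) (grad (w i) x)) Ω :=
  (integrable_finsetSum _ fun _ _ => L2.integrable_inner _ _).const_mul _

lemma formAV_sub_left (D : Data Ω) (v v' w : Vel Ω) :
    formAV D (v - v') w = formAV D v w - formAV D v' w := by
  unfold formAV
  rw [← integral_sub (integrableOn_formAV D v w) (integrableOn_formAV D v' w)]
  refine integral_congr_ae ?_
  filter_upwards [grad_sub_ae (v 0) (v' 0), grad_sub_ae (v 1) (v' 1)] with x h0 h1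
  simp only [Fin.sum_univ_two, Pi.sub_apply, h0, h1, inner_sub_left]
  ring

lemma formAV_self (D : Data Ω) (v : Vel Ω) : formAV D v v = D.μ * Vel.seminorm v ^ 2 := by
  unfold formAV
  rw [integral_const_mul, integral_finsetSum _ fun _ _ => L2.integrable_inner _ _, v.seminorm_sq]
  congr 1
  refine Finset.sum_congr rfl fun i _ => ?_
  rw [← L2.inner_def, real_inner_self_eq_norm_sq]

lemma integrableOn_formB (v : Vel Ω) (q : Pres Ω) :
    IntegrableOn (fun x => v.div x * q.1 x) Ω :=
  integrable_mul_of_memLp_two v.memLp_div (Lp.memLp q.1)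

lemma formB_sub_left (v v' : Vel Ω) (q : Pres Ω) :
    formB (v - v') q = formB v q - formB v' q := by
  unfold formB
  rw [← integral_sub (integrableOn_formB v q) (integrableOn_formB v' q)]
  refine integral_congr_ae ?_
  filter_upwards [v.div_sub_ae v'] with x h
  rw [h]
  ring

/-- The incompressibility constraint in the flow problem. -/
lemma formB_eq_zero_of_mem_flow {D : Data Ω} {ψ : H10 Ω} {u : Vel Ω} {p : Pres Ω}
    (h : (u, p) ∈ flow D ψ) (q : Pres Ω) : formB u q = 0 := by
  have hz : ∀ᵐ x ∂volume.restrict Ω, (0 : L2 Ω) x = 0 := Lp.coeFn_zero _ _ _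
  let z : Pres Ω := ⟨0, integral_eq_zero_of_ae hz⟩
  have h0 : formB u z = 0 := by
    refine integral_eq_zero_of_ae ?_
    filter_upwards [hz] with x hx
    exact mul_eq_zero_of_right _ hx
  -- With zero test velocity the two equations differ only in their pressure term, so subtracting
  -- them isolates `formB u q` without evaluating the rest.
  have h1 := h 0 q
  have h2 := h 0 z
  unfold formCalA at h1 h2
  linarith

/-! ### Lipschitz estimate for the flow problem -/

section FlowForms

variable {D : Data Ω} {Estar C : ℝ}

lemma formC_bound (hEmeas : AEStronglyMeasurable D.E (volume.restrict Ω)) (hEstar : 0 < Estar)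
    (hE : ∀ᵐ x ∂volume.restrict Ω, ‖D.E x‖ ≤ Estar) (hC : IsSobolevConst Ω C) (ψ : H10 Ω)
    (v w : Vel Ω) :
    IntegrableOn (fun x => inner ℝ (v.field x) (grad ψ x) * inner ℝ (D.E x) (w.field x)) Ω ∧
      |formC D ψ v w| ≤ Estar * C ^ 2 * Vel.seminorm v * ‖grad ψ‖ * Vel.seminorm w := by
  have hs := v.seminorm_nonneg
  have hs' := w.seminorm_nonneg
  have hC0 := hC.1
  have := integrable_and_abs_integral_le_of_le_mul_mul (ν := volume.restrict Ω)
    (h := fun x => inner ℝ (v.field x) (grad ψ x) * inner ℝ (D.E x) (w.field x)) (c := Estar)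
    ((v.aestronglyMeasurable_field.inner (aestronglyMeasurable_grad ψ)).mul
      (hEmeas.inner w.aestronglyMeasurable_field))
    v.aestronglyMeasurable_field (aestronglyMeasurable_grad ψ) w.aestronglyMeasurable_field
    hEstar.le (by positivity) (norm_nonneg (grad ψ)) (by positivity)
    (by
      filter_upwards [hE] with x hx
      rw [abs_mul]
      calc _ ≤ (‖v.field x‖ * ‖grad ψ x‖) * (‖D.E x‖ * ‖w.field x‖) :=
            mul_le_mul (abs_real_inner_le_norm _ _) (abs_real_inner_le_norm _ _)
              (abs_nonneg _) (by positivity)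
        _ ≤ (‖v.field x‖ * ‖grad ψ x‖) * (Estar * ‖w.field x‖) := by gcongr
        _ = _ := by ring)
    (v.eLpNorm_field_four_le hC) (eLpNorm_Lp _).le (w.eLpNorm_field_four_le hC)
  refine ⟨this.1, this.2.trans_eq ?_⟩
  ring

/-- Inserting c(ψ; v', w) separates a part to be absorbed by viscosity, as ψ lies in the ball, from
a part controlled by ψ - ψ'. Hence only the second velocity enters the final constant. -/
lemma formC_sub (hEmeas : AEStronglyMeasurable D.E (volume.restrict Ω)) (hEstar : 0 < Estar)
    (hE : ∀ᵐ x ∂volume.restrict Ω, ‖D.E x‖ ≤ Estar) (hC : IsSobolevConst Ω C) (ψ ψ' : H10 Ω)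
    (v v' w : Vel Ω) :
    formC D ψ v w - formC D ψ' v' w = formC D ψ (v - v') w + formC D (ψ - ψ') v' w := by
  have i := fun ψ v => (formC_bound (D := D) hEmeas hEstar hE hC ψ v w).1
  unfold formC
  rw [← integral_sub (i ψ v) (i ψ' v'), ← integral_add (i ψ _) (i _ v')]
  refine integral_congr_ae ?_
  filter_upwards [v.field_sub_ae v', grad_sub_ae ψ ψ'] with x h1 h2
  rw [h1, h2, inner_sub_left, inner_sub_right]
  ring

variable {κstar CP : ℝ} {Λ₁ Λ₂ : EReal}

lemma memLp_inner_field (hEmeas : AEStronglyMeasurable D.E (volume.restrict Ω))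
    (hE : ∀ᵐ x ∂volume.restrict Ω, ‖D.E x‖ ≤ Estar) (v : Vel Ω) :
    MemLp (fun x => inner ℝ (D.E x) (v.field x)) 2 (volume.restrict Ω) := by
  refine v.memLp_field.of_le_mul (c := Estar) (hEmeas.inner v.aestronglyMeasurable_field) ?_
  filter_upwards [hE] with x hx
  exact (norm_inner_le_norm _ _).trans (by gcongr)

/-- The range contains 0 and κ(0) = 0, so the Lipschitz bound gives linear growth; monotonicity
gives measurability. -/
lemma memLp_charge (hΛ₁ : Λ₁ ≤ 0) (hΛ₂ : 0 ≤ Λ₂) (hκ0 : D.κ 0 = 0) (hκmono : Monotone D.κ)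
    (hκlip : ∀ s t : ℝ, Λ₁ ≤ (s : EReal) → (s : EReal) ≤ Λ₂ → Λ₁ ≤ (t : EReal) →
      (t : EReal) ≤ Λ₂ → |D.κ s - D.κ t| ≤ κstar * |s - t|) {ψ : H10 Ω}
    (hψ : ∀ᵐ x ∂volume.restrict Ω, Λ₁ ≤ (fn ψ x : EReal) ∧ (fn ψ x : EReal) ≤ Λ₂) :
    MemLp (fun x => D.κ (fn ψ x)) 2 (volume.restrict Ω) := by
  refine (Lp.memLp (fn ψ)).of_le_mul (c := κstar)
    (hκmono.measurable.comp_aemeasurable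
      (aestronglyMeasurable_fn ψ).aemeasurable).aestronglyMeasurable ?_
  filter_upwards [hψ] with x hx
  simpa [hκ0] using hκlip _ 0 hx.1 hx.2 (by simpa using hΛ₁) (by simpa using hΛ₂)

/-- The loads `f` and `g` cancel. Poincaré is used twice, for ψ - ψ' and for `v`, whence `CP ^ 2`.
-/
lemma abs_loadF_sub_le (hEmeas : AEStronglyMeasurable D.E (volume.restrict Ω)) (hEstar : 0 < Estar)
    (hE : ∀ᵐ x ∂volume.restrict Ω, ‖D.E x‖ ≤ Estar)
    (hΛ₁ : Λ₁ ≤ 0) (hΛ₂ : 0 ≤ Λ₂) (hκstar : 0 < κstar)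
    (hκ0 : D.κ 0 = 0) (hκmono : Monotone D.κ)
    (hκlip : ∀ s t : ℝ, Λ₁ ≤ (s : EReal) → (s : EReal) ≤ Λ₂ → Λ₁ ≤ (t : EReal) →
      (t : EReal) ≤ Λ₂ → |D.κ s - D.κ t| ≤ κstar * |s - t|)
    (hCP : IsPoincareConst Ω CP) {ψ ψ' : H10 Ω}
    (hψ : ∀ᵐ x ∂volume.restrict Ω, Λ₁ ≤ (fn ψ x : EReal) ∧ (fn ψ x : EReal) ≤ Λ₂)
    (hψ' : ∀ᵐ x ∂volume.restrict Ω, Λ₁ ≤ (fn ψ' x : EReal) ∧ (fn ψ' x : EReal) ≤ Λ₂)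
    (v : Vel Ω) :
    |loadF D ψ v - loadF D ψ' v| ≤
      κstar * Estar * CP ^ 2 * ‖grad (ψ - ψ')‖ * Vel.seminorm v := by
  have m := memLp_charge hΛ₁ hΛ₂ hκ0 hκmono hκlip hψ
  have m' := memLp_charge hΛ₁ hΛ₂ hκ0 hκmono hκlip hψ'
  have mE := memLp_inner_field (D := D) hEmeas hE v
  have hs := v.seminorm_nonneg
  have hP := hCP.1
  have i := integrable_mul_of_memLp_two ((Lp.memLp D.g).sub m) mE
  have i' := integrable_mul_of_memLp_two ((Lp.memLp D.g).sub m') mE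
  simp only [Pi.sub_apply] at i i'
  have e : loadF D ψ v - loadF D ψ' v =
      ∫ x in Ω, (D.κ (fn ψ' x) - D.κ (fn ψ x)) * inner ℝ (D.E x) (v.field x) := by
    unfold loadF
    rw [add_sub_add_left_eq_sub, ← integral_sub i i']
    congr 1
    ext x
    ring
  rw [e]
  refine (integrable_and_abs_integral_le_of_le_mul (ν := volume.restrict Ω)
    (h := fun x => (D.κ (fn ψ' x) - D.κ (fn ψ x)) * inner ℝ (D.E x) (v.field x))
    (a := fn (ψ - ψ')) (b := v.field) (c := κstar * Estar) (A := CP * ‖grad (ψ - ψ')‖)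
    (B := CP * Vel.seminorm v) ((m'.1.sub m.1).mul mE.1) (aestronglyMeasurable_fn _)
    v.aestronglyMeasurable_field (by positivity) (by positivity) (by positivity) ?_ ?_
    (v.eLpNorm_field_two_le hCP)).2.trans_eq (by ring)
  · filter_upwards [hE, hψ, hψ', fn_sub_ae ψ ψ'] with x hx h h' hs
    rw [abs_mul, hs, Real.norm_eq_abs, abs_sub_comm]
    calc _ ≤ (κstar * |fn ψ x - fn ψ' x|) * (‖D.E x‖ * ‖v.field x‖) :=
          mul_le_mul (hκlip _ _ h.1 h.2 h'.1 h'.2) (abs_real_inner_le_norm _ _) (abs_nonneg _)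
            (by positivity)
      _ ≤ (κstar * |fn ψ x - fn ψ' x|) * (Estar * ‖v.field x‖) := by gcongr
      _ = _ := by ring
  · rw [eLpNorm_Lp]
    exact ENNReal.ofReal_le_ofReal (hCP.2 _)

/-- Here `n`, `d`, `s`, `s'` stand for the norms of ∇ψ, ∇(ψ - ψ'), ∇(u - u'), ∇u'. The radius
bounding `n` is the one for which the coupling term takes exactly half of `μ * s ^ 2`. -/
lemma coercivity_arith {μ Es κs P C n d s s' c c' l : ℝ} (hμ : 0 < μ) (hEs : 0 < Es) (hC : 0 < C)
    (hκs : 0 ≤ κs) (hd : 0 ≤ d) (hs : 0 ≤ s) (hs' : 0 ≤ s') (hn : n ≤ μ / (2 * Es * C ^ 2))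
    (h1 : -(Es * C ^ 2 * s * n * s) ≤ c) (h2 : -(Es * C ^ 2 * s' * d * s) ≤ c')
    (h3 : l ≤ κs * Es * P ^ 2 * d * s) (e : μ * s ^ 2 + c + c' = l) :
    s ≤ 2 * Es / μ * (κs * P ^ 2 + C ^ 2 * s') * d := by
  have h4 : Es * C ^ 2 * s * n * s ≤ μ / 2 * s ^ 2 := by
    calc Es * C ^ 2 * s * n * s = Es * C ^ 2 * s ^ 2 * n := by ring
      _ ≤ Es * C ^ 2 * s ^ 2 * (μ / (2 * Es * C ^ 2)) := by gcongr
      _ = _ := by field_simp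
  have main : μ / 2 * s * s ≤ Es * (κs * P ^ 2 + C ^ 2 * s') * d * s := by linarith
  rcases hs.eq_or_lt with h0 | h0
  · rw [← h0]
    positivity
  · have := le_of_mul_le_mul_right main h0
    rw [show 2 * Es / μ * (κs * P ^ 2 + C ^ 2 * s') * d =
      2 * (Es * (κs * P ^ 2 + C ^ 2 * s') * d) / μ by ring, le_div_iff₀ hμ]
    linarith

/-- Lipschitz dependence of the velocity on the potential. -/
lemma seminorm_sub_le_of_mem_flow₁ (hμ : 0 < D.μ)
    (hEmeas : AEStronglyMeasurable D.E (volume.restrict Ω)) (hEstar : 0 < Estar)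
    (hE : ∀ᵐ x ∂volume.restrict Ω, ‖D.E x‖ ≤ Estar)
    (hΛ₁ : Λ₁ ≤ 0) (hΛ₂ : 0 ≤ Λ₂) (hκstar : 0 < κstar)
    (hκ0 : D.κ 0 = 0) (hκmono : Monotone D.κ)
    (hκlip : ∀ s t : ℝ, Λ₁ ≤ (s : EReal) → (s : EReal) ≤ Λ₂ → Λ₁ ≤ (t : EReal) →
      (t : EReal) ≤ Λ₂ → |D.κ s - D.κ t| ≤ κstar * |s - t|)
    (hCP : IsPoincareConst Ω CP) (hC : IsSobolevConst Ω C) {ψ ψ' : H10 Ω}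
    (hψ : ψ ∈ phiHat D Estar C Λ₁ Λ₂) (hψ' : ψ' ∈ phiHat D Estar C Λ₁ Λ₂) {u u' : Vel Ω}
    (hu : u ∈ flow₁ D ψ) (hu' : u' ∈ flow₁ D ψ') :
    Vel.seminorm (u - u') ≤ 2 * Estar / D.μ * (κstar * CP ^ 2 + C ^ 2 * Vel.seminorm u') *
      ‖grad (ψ - ψ')‖ := by
  obtain ⟨p, hp⟩ := hu
  obtain ⟨p', hp'⟩ := hu'
  have hB := formB_eq_zero_of_mem_flow hp
  have hB' := formB_eq_zero_of_mem_flow hp'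
  have hBw : ∀ q, formB (u - u') q = 0 := fun q => by rw [formB_sub_left, hB, hB', sub_zero]
  -- The choice of test pressure is immaterial, since all the forms b vanish.
  have e := hp (u - u') p
  have e' := hp' (u - u') p
  simp only [formCalA, hB, hB', hBw] at e e'
  have eA := formAV_sub_left D u u' (u - u')
  rw [formAV_self] at eA
  have eC := formC_sub (D := D) hEmeas hEstar hE hC ψ ψ' u u' (u - u')
  have b1 := (abs_le.1 (formC_bound (D := D) hEmeas hEstar hE hC ψ (u - u') (u - u')).2).1
  have b2 := (abs_le.1 (formC_bound (D := D) hEmeas hEstar hE hC (ψ - ψ') u' (u - u')).2).1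
  have b3 := (abs_le.1 (abs_loadF_sub_le (D := D) hEmeas hEstar hE hΛ₁ hΛ₂ hκstar hκ0 hκmono
    hκlip hCP hψ.2 hψ'.2 (u - u'))).2
  refine coercivity_arith hμ hEstar hC.1 hκstar.le (norm_nonneg _)
    (Vel.seminorm_nonneg _) (Vel.seminorm_nonneg _) hψ.1 b1 b2 b3 ?_
  linarith

end FlowForms

/-! ### Energy and Lipschitz estimates for the potential problem -/

section Potential

variable {D : Data Ω} {C CP : ℝ}

lemma formAP_sub_left (D : Data Ω) (φ φ' ξ : H10 Ω) :
    formAP D (φ - φ') ξ = formAP D φ ξ - formAP D φ' ξ := by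
  have i := fun φ : H10 Ω => (L2.integrable_inner (𝕜 := ℝ) (grad φ) (grad ξ)).const_mul D.ε
  unfold formAP
  rw [← integral_sub (i φ) (i φ')]
  refine integral_congr_ae ?_
  filter_upwards [grad_sub_ae φ φ'] with x h
  rw [h, inner_sub_left]
  ring

lemma formAP_self (D : Data Ω) (φ : H10 Ω) : formAP D φ φ = D.ε * ‖grad φ‖ ^ 2 := by
  unfold formAP
  rw [integral_const_mul, ← L2.inner_def, real_inner_self_eq_norm_sq]

/-- The energy estimate for the potential. -/
lemma norm_grad_le_of_mem_elec (hΩb : Bornology.IsBounded Ω)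
    (hκ0 : D.κ 0 = 0) (hκmono : Monotone D.κ)
    (hCP : IsPoincareConst Ω CP) (hC : IsSobolevConst Ω C) {u : Vel Ω}
    (hu : ∀ᵐ x ∂volume.restrict Ω, Vel.div u x = 0) {φ : H10 Ω} (hφ : φ ∈ elec D u) :
    D.ε * ‖grad φ‖ ≤ CP * ‖D.g‖ := by
  have e := hφ.2 φ
  have hd : 0 ≤ formD D φ φ := integral_nonneg fun x => by
    rcases le_total 0 (fn φ x) with h | h
    · exact mul_nonneg (by simpa [hκ0] using hκmono h) h
    · exact mul_nonneg_of_nonpos_of_nonpos (by simpa [hκ0] using hκmono h) h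
  have hg : ∫ x in Ω, D.g x * fn φ x ≤ ‖D.g‖ * (CP * ‖grad φ‖) := by
    have e1 : ∫ x in Ω, D.g x * fn φ x = inner ℝ D.g (fn φ) := by
      rw [L2.inner_def]
      simp [mul_comm]
    rw [e1]
    exact (real_inner_le_norm _ _).trans (by gcongr; exact hCP.2 φ)
  rw [formCalB, formAP_self, formCP_self hC hΩb hu] at e
  have main : D.ε * ‖grad φ‖ * ‖grad φ‖ ≤ CP * ‖D.g‖ * ‖grad φ‖ := by linarith
  rcases (norm_nonneg (grad φ)).eq_or_lt with h0 | h0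
  · rw [← h0, mul_zero]
    exact mul_nonneg hCP.1.le (norm_nonneg _)
  · exact le_of_mul_le_mul_right main h0

/-- Lipschitz dependence of the potential on the velocity. -/
lemma norm_grad_sub_le_of_mem_elec (hΩb : Bornology.IsBounded Ω)
    (hκmono : Monotone D.κ) (hC : IsSobolevConst Ω C) {u u' : Vel Ω}
    (hu : ∀ᵐ x ∂volume.restrict Ω, Vel.div u x = 0) {φ φ' : H10 Ω}
    (hφ : φ ∈ elec D u) (hφ' : φ' ∈ elec D u') :
    D.ε * ‖grad (φ - φ')‖ ≤ C ^ 2 * Vel.seminorm (u - u') * ‖grad φ'‖ := by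
  have e := hφ.2 (φ - φ')
  have e' := hφ'.2 (φ - φ')
  -- Monotonicity holds on all of ℝ, so the potentials need no range bounds here. Splitting the
  -- integral rests on the integrability required in `elec`.
  have hd : 0 ≤ formD D φ (φ - φ') - formD D φ' (φ - φ') := by
    unfold formD
    rw [← integral_sub (hφ.1 _) (hφ'.1 _)]
    refine integral_nonneg_of_ae ?_
    filter_upwards [fn_sub_ae φ φ'] with x hx
    rw [hx, ← sub_mul]
    rcases le_total (fn φ' x) (fn φ x) with h | h
    · exact mul_nonneg (sub_nonneg.2 (hκmono h)) (sub_nonneg.2 h)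
    · exact mul_nonneg_of_nonpos_of_nonpos (sub_nonpos.2 (hκmono h)) (sub_nonpos.2 h)
  have eA := formAP_sub_left D φ φ' (φ - φ')
  rw [formAP_self] at eA
  -- The convection difference is c_p(u; φ - φ', φ - φ') + c_p(u - u'; φ', φ - φ'), whose first term
  -- vanishes because u is divergence free.
  have e1 := formCP_sub_mid hC u φ φ' (φ - φ')
  rw [formCP_self hC hΩb hu] at e1
  have e2 := formCP_sub_left hC u u' φ' (φ - φ')
  have b := (abs_le.1 (formCP_bound hC (u - u') φ' (φ - φ')).2).1
  unfold formCalB at e e'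
  have main : D.ε * ‖grad (φ - φ')‖ * ‖grad (φ - φ')‖ ≤
      C ^ 2 * Vel.seminorm (u - u') * ‖grad φ'‖ * ‖grad (φ - φ')‖ := by linarith
  rcases (norm_nonneg (grad (φ - φ'))).eq_or_lt with h0 | h0
  · rw [← h0, mul_zero]
    have := (u - u').seminorm_nonneg
    positivity
  · exact le_of_mul_le_mul_right main h0

/-- Composition of the Lipschitz bounds of the flow and of the potential problem. -/
lemma contraction_arith {μ ε Es CP C κs G n d s s' x : ℝ} (hμ : 0 < μ) (hε : 0 < ε) (hEs : 0 < Es)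
    (hCP : 0 < CP) (hκs : 0 ≤ κs) (hn : 0 ≤ n) (hd : 0 ≤ d) (hs' : 0 ≤ s')
    (hG : 2 * CP * Es * C ^ 2 / (μ * ε) * G < 1) (h1 : ε * x ≤ C ^ 2 * s * n)
    (h2 : ε * n ≤ CP * G) (h3 : s ≤ 2 * Es / μ * (κs * CP ^ 2 + C ^ 2 * s') * d) :
    x ≤ 1 / ε * (κs * CP ^ 2 + C ^ 2 * s') * d := by
  have h2' : n ≤ CP * G / ε := by
    rw [le_div_iff₀ hε]
    linarith
  have hR : 0 ≤ (κs * CP ^ 2 + C ^ 2 * s') * d := by positivity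
  have h : ε * x ≤ (κs * CP ^ 2 + C ^ 2 * s') * d :=
    calc ε * x ≤ C ^ 2 * s * n := h1
      _ ≤ C ^ 2 * (2 * Es / μ * (κs * CP ^ 2 + C ^ 2 * s') * d) * (CP * G / ε) := by gcongr
      _ = (2 * CP * Es * C ^ 2 / (μ * ε) * G) * ((κs * CP ^ 2 + C ^ 2 * s') * d) := by
          field_simp
      _ ≤ 1 * ((κs * CP ^ 2 + C ^ 2 * s') * d) := by gcongr
      _ = _ := one_mul _
  rw [mul_assoc, one_div_mul_eq_div, le_div_iff₀ hε]
  linarith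

end Potential

end SPB

end

/-! ### The Lipschitz estimate for the composite operator -/

theorem mainTheorem8
    (Ω : Set SPB.Plane) (hΩ : IsOpen Ω) (hΩb : Bornology.IsBounded Ω)
    (D : SPB.Data Ω) (hμ : 0 < D.μ) (hε : 0 < D.ε)
    -- the electric field is bounded by `Estar`
    (Estar : ℝ) (hEstar : 0 < Estar)
    (hEmeas : AEStronglyMeasurable D.E (volume.restrict Ω))
    (hE : ∀ᵐ x ∂volume.restrict Ω, ‖D.E x‖ ≤ Estar)
    -- the charge density is nondecreasing, and Lipschitz on the range of the potentials
    (Λ₁ Λ₂ : EReal) (hΛ₁ : Λ₁ ≤ 0) (hΛ₂ : 0 ≤ Λ₂)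
    (κstar : ℝ) (hκstar : 0 < κstar)
    (hκ0 : D.κ 0 = 0) (hκmono : Monotone D.κ)
    (hκlip : ∀ s t : ℝ, Λ₁ ≤ (s : EReal) → (s : EReal) ≤ Λ₂ → Λ₁ ≤ (t : EReal) →
      (t : EReal) ≤ Λ₂ → |D.κ s - D.κ t| ≤ κstar * |s - t|)
    -- constants of the Poincaré inequality and of the Sobolev embedding
    (CP C : ℝ) (hCP : SPB.IsPoincareConst Ω CP) (hC : SPB.IsSobolevConst Ω C)
    -- smallness of the potential load
    (hg : 2 * CP * Estar * C ^ 2 / (D.μ * D.ε) * ‖D.g‖ < 1) :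
    (∀ ψ ∈ SPB.phiHat D Estar C Λ₁ Λ₂,
      (SPB.flow₁ D ψ).Subsingleton ∧ (SPB.opT D ψ).Subsingleton) ∧
    ∀ ψ ∈ SPB.phiHat D Estar C Λ₁ Λ₂, ∀ ψ' ∈ SPB.phiHat D Estar C Λ₁ Λ₂,
      ∀ u' ∈ SPB.flow₁ D ψ', ∀ φ ∈ SPB.opT D ψ, ∀ φ' ∈ SPB.opT D ψ',
        ‖SPB.grad (φ - φ')‖ ≤
          1 / D.ε * (κstar * CP ^ 2 + C ^ 2 * SPB.Vel.seminorm u') *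
            ‖SPB.grad (ψ - ψ')‖ := by
  have hdiv : ∀ {ψ : SPB.H10 Ω} {u : SPB.Vel Ω}, u ∈ SPB.flow₁ D ψ →
      ∀ᵐ x ∂volume.restrict Ω, SPB.Vel.div u x = 0 := by
    rintro ψ u ⟨p, hp⟩
    exact SPB.Vel.div_eq_zero hΩb (SPB.formB_eq_zero_of_mem_flow hp)
  have hflow : ∀ ψ ∈ SPB.phiHat D Estar C Λ₁ Λ₂, ∀ ψ' ∈ SPB.phiHat D Estar C Λ₁ Λ₂,
      ∀ u ∈ SPB.flow₁ D ψ, ∀ u' ∈ SPB.flow₁ D ψ', SPB.Vel.seminorm (u - u') ≤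
        2 * Estar / D.μ * (κstar * CP ^ 2 + C ^ 2 * SPB.Vel.seminorm u') *
          ‖SPB.grad (ψ - ψ')‖ := fun ψ hψ ψ' hψ' u hu u' hu' =>
    SPB.seminorm_sub_le_of_mem_flow₁ hμ hEmeas hEstar hE hΛ₁ hΛ₂ hκstar hκ0 hκmono hκlip hCP hC
      hψ hψ' hu hu'
  have hzero : ∀ ψ : SPB.H10 Ω, ‖SPB.grad (ψ - ψ)‖ = 0 := fun ψ => by
    rw [sub_self]
    exact norm_zero
  have hunique : ∀ ψ ∈ SPB.phiHat D Estar C Λ₁ Λ₂, (SPB.flow₁ D ψ).Subsingleton := by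
    intro ψ hψ u hu u' hu'
    have := hflow ψ hψ ψ hψ u hu u' hu'
    rw [hzero, mul_zero] at this
    exact hCP.vel_eq (le_antisymm this (SPB.Vel.seminorm_nonneg _))
  have hlip : ∀ ψ ∈ SPB.phiHat D Estar C Λ₁ Λ₂, ∀ ψ' ∈ SPB.phiHat D Estar C Λ₁ Λ₂,
      ∀ u' ∈ SPB.flow₁ D ψ', ∀ φ ∈ SPB.opT D ψ, ∀ φ' ∈ SPB.opT D ψ',
        ‖SPB.grad (φ - φ')‖ ≤ 1 / D.ε * (κstar * CP ^ 2 + C ^ 2 * SPB.Vel.seminorm u') *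
          ‖SPB.grad (ψ - ψ')‖ := by
    rintro ψ hψ ψ' hψ' u' hu' φ ⟨u, hu, hφ⟩ φ' ⟨u'', hu'', hφ'⟩
    -- The velocity that produces φ' must be the one in the bound; uniqueness of the flow identifies
    -- them.
    obtain rfl := hunique ψ' hψ' hu' hu''
    have h1 := SPB.norm_grad_sub_le_of_mem_elec hΩb hκmono hC (hdiv hu) hφ hφ'
    have h2 := SPB.norm_grad_le_of_mem_elec hΩb hκ0 hκmono hCP hC (hdiv hu') hφ'
    have h3 := hflow ψ hψ ψ' hψ' u hu u' hu'
    exact SPB.contraction_arith hμ hε hEstar hCP.1 hκstar.le (norm_nonneg _) (norm_nonneg _)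
      (SPB.Vel.seminorm_nonneg _) hg h1 h2 h3
  refine ⟨fun ψ hψ => ⟨hunique ψ hψ, ?_⟩, hlip⟩
  intro φ hφ φ' hφ'
  -- The bound needs some flow velocity at ψ; membership in `opT` supplies one.
  have hφ₀ := hφ'
  obtain ⟨u, hu, -⟩ := hφ₀
  have := hlip ψ hψ ψ hψ u hu φ hφ φ' hφ'
  rw [hzero, mul_zero] at this
  exact sub_eq_zero.1 (hCP.eq_zero (le_antisymm this (norm_nonneg _)))
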